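/- Let $c,d,n$ be nonnegative integers, let $\mathcal G_{c,d}=\begin{pmatrix}\mathbf 1_c&0\\0&-\mathbf 1_d\end{pmatrix}$, and let $\mathrm U(c,d)=\{\mathcal T\in\mathrm{Mat}(c+d,\mathbb C):\mathcal T^*\mathcal G_{c,d}\mathcal T=\mathcal G_{c,d}\}$. For $\theta\in[0,1]$ put $\mathcal U_\theta=\begin{pmatrix}e^{2\pi i\theta}\mathbf 1_c&0\\0&\mathbf 1_d\end{pmatrix}$, and for $\mathcal T\in\mathrm{GL}(c+d,\mathbb C)$ put $$N_d(\mathcal T)=\sum_{i=1}^d\ln\left(\frac{\sigma_i(\mathcal T)+\sigma_i(\mathcal T)^{-1}}{2}\right),$$ where $\sigma_1(\mathcal T)\ge\sigma_2(\mathcal T)\ge\dots\ge\sigma_{c+d}(\mathcal T)$ are the singular values of $\mathcal T$. Let $\Lambda^d\mathcal T$ denote the $d$-th exterior power of $\mathcal T$ and $\rho$ the spectral radius. Then for all $\mathcal T_1,\dots,\mathcal T_n\in\mathrm U(c,d)$ the two integrands below are integrable on $[0,1]$, and $$\int_0^1N_d(\mathcal U_\theta\mathcal T_1\,\mathcal U_\theta\mathcal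 T_2\cdots\mathcal U_\theta\mathcal T_n)\,d\theta=\sum_{j=1}^nN_d(\mathcal T_j)$$ and $$\int_0^1\ln\rho\bigl(\Lambda^d(\mathcal U_\theta\mathcal T_1\,\mathcal U_\theta\mathcal T_2\cdots\mathcal U_\theta\mathcal T_n)\bigr)\,d\theta=\sum_{j=1}^nN_d(\mathcal T_j).$$ -/

import Mathlib

noncomputable section

/-- The matrix `diag(1_c, -1_d)` of the standard hermitian form of signature `(c, d)`. -/
def signatureForm (c d : ℕ) : Matrix (Fin c ⊕ Fin d) (Fin c ⊕ Fin d) ℂ :=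
  Matrix.fromBlocks 1 0 0 (-1)

/-- The pseudo-unitary group `U(c, d)`: all `T` with `T* G T = G`, `G = diag(1_c, -1_d)`. -/
def pseudoUnitary (c d : ℕ) : Set (Matrix (Fin c ⊕ Fin d) (Fin c ⊕ Fin d) ℂ) :=
  {T | T.conjTranspose * signatureForm c d * T = signatureForm c d}

/-- The unitary block matrix `diag(e^{2πiθ} 1_c, 1_d)`. -/
def phaseMatrix (c d : ℕ) (θ : ℝ) : Matrix (Fin c ⊕ Fin d) (Fin c ⊕ Fin d) ℂ :=
  Matrix.fromBlocks (Complex.exp (2 * Real.pi * Complex.I * θ) • 1) 0 0 1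

/-- `N_r(T) = ∑_{i=1}^r ln ((σ_i(T) + σ_i(T)⁻¹) / 2)`, where `σ_1(T) ≥ σ_2(T) ≥ …` are the singular
values of `T` (indexed from `0` in Mathlib). -/
def sumLogCosh {m : Type*} [Fintype m] [DecidableEq m] (r : ℕ) (T : Matrix m m ℂ) : ℝ :=
  ∑ i ∈ Finset.range r,
    Real.log ((T.toEuclideanLin.singularValues i + (T.toEuclideanLin.singularValues i)⁻¹) / 2)

/-- The spectral radius `ρ(Λ^r T)` of the `r`-th exterior power of `T`. -/
def exteriorSpectralRadius {m : Type*} [Fintype m] [DecidableEq m] (r : ℕ) (T : Matrix m m ℂ) : ℝ :=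
  (spectralRadius ℂ
    (exteriorPower.map r (Matrix.toLin' T) : Module.End ℂ (⋀[ℂ]^r (m → ℂ)))).toReal

/-- The ordered product `U_θ T_1 U_θ T_2 ⋯ U_θ T_n`. -/
def phaseProduct {c d n : ℕ} (T : Fin n → Matrix (Fin c ⊕ Fin d) (Fin c ⊕ Fin d) ℂ) (θ : ℝ) :
    Matrix (Fin c ⊕ Fin d) (Fin c ⊕ Fin d) ℂ :=
  (List.ofFn fun j => phaseMatrix c d θ * T j).prod

end

section
open Matrix Filter Topology
open scoped ComplexOrder

/-! ### Block relations in `U(c, d)`. -/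

section
variable {c d : ℕ} {T : Matrix (Fin c ⊕ Fin d) (Fin c ⊕ Fin d) ℂ}

/-! Write `T` in blocks `A, B; C, D` and `G` for the form. Everything rests on `N_d(T) = log |det
D|` for `T` in `U(c, d)` (`sumLogCosh_eq_log_norm_det`): `P = T*T` satisfies `GPG = P⁻¹`, so `(P +
1)² = P (P + P⁻¹ + 2) = 4 P diag(A*A, D*D)`, and singular values come in inverse pairs.

Replace the phase by `z` in the closed unit disc. The product `M(z)` then satisfies `M*GM ≤ G`,
which keeps its `D`-block invertible. So `log |det D(z)|` has the mean value property, and at `z =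
0` every factor is block lower triangular, whence `det D(0) = ∏ det D_j`. This is the first formula.

For the second, apply the same computation to `M(z)^k`. The number `det D` is a coefficient of
`Λ^d`, bounded below by `1/d!`, and dominates all `d × d` minors up to `(2d)!`
(`norm_det_submatrix_le`). Gelfand's formula thus gives `(1/k) log |det D(M^k)| → log ρ(Λ^d M)`, and
dominated convergence passes to the integral. -/

theorem signatureForm_mul_self (c d : ℕ) : signatureForm c d * signatureForm c d = 1 := by
  simp [signatureForm, fromBlocks_multiply]

theorem pseudoUnitary_conjTranspose (hT : T ∈ pseudoUnitary c d) : Tᴴ ∈ pseudoUnitary c d := by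
  have h1 : (signatureForm c d * Tᴴ * signatureForm c d) * T = 1 := by
    rw [Matrix.mul_assoc, Matrix.mul_assoc, ← Matrix.mul_assoc Tᴴ, hT.out, signatureForm_mul_self]
  have h2 := mul_eq_one_comm.mp h1
  show Tᴴᴴ * _ * Tᴴ = _
  rw [conjTranspose_conjTranspose]
  calc T * signatureForm c d * Tᴴ
      = (T * (signatureForm c d * Tᴴ * signatureForm c d)) * signatureForm c d := by
        simp only [Matrix.mul_assoc, signatureForm_mul_self, Matrix.mul_one]
    _ = _ := by rw [h2, Matrix.one_mul]

theorem pseudoUnitary_mul {S : Matrix (Fin c ⊕ Fin d) (Fin c ⊕ Fin d) ℂ}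
    (hS : S ∈ pseudoUnitary c d) (hT : T ∈ pseudoUnitary c d) : S * T ∈ pseudoUnitary c d := by
  show (S * T)ᴴ * signatureForm c d * (S * T) = _
  have : (S * T)ᴴ * signatureForm c d * (S * T) = Tᴴ * (Sᴴ * signatureForm c d * S) * T := by
    simp only [conjTranspose_mul, Matrix.mul_assoc]
  rw [this, hS.out, hT.out]

theorem pseudoUnitary_one : (1 : Matrix (Fin c ⊕ Fin d) (Fin c ⊕ Fin d) ℂ) ∈ pseudoUnitary c d := by
  show _ = _
  simp

theorem pseudoUnitary_pow (hT : T ∈ pseudoUnitary c d) (k : ℕ) : T ^ k ∈ pseudoUnitary c d := by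
  induction k with
  | zero => simpa using pseudoUnitary_one
  | succ k ih => rw [pow_succ]; exact pseudoUnitary_mul ih hT

theorem pseudoUnitary_blocks (hT : T ∈ pseudoUnitary c d) :
    T.toBlocks₁₁ᴴ * T.toBlocks₁₁ = 1 + T.toBlocks₂₁ᴴ * T.toBlocks₂₁ ∧
    T.toBlocks₁₁ᴴ * T.toBlocks₁₂ = T.toBlocks₂₁ᴴ * T.toBlocks₂₂ ∧
    T.toBlocks₂₂ᴴ * T.toBlocks₂₂ = 1 + T.toBlocks₁₂ᴴ * T.toBlocks₁₂ := by
  have h : Tᴴ * signatureForm c d * T = signatureForm c d := hT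
  rw [← fromBlocks_toBlocks T] at h
  simp only [signatureForm, fromBlocks_conjTranspose, fromBlocks_multiply, fromBlocks_inj] at h
  simp only [Matrix.mul_one, Matrix.mul_zero, add_zero, zero_add, Matrix.mul_neg, Matrix.neg_mul]
    at h
  obtain ⟨h1, h2, -, h4⟩ := h
  refine ⟨?_, ?_, ?_⟩
  · rw [← h1]; abel
  · rw [← sub_eq_zero, ← h2]; abel
  · rw [← neg_inj, neg_add, ← h4]; abel

theorem pseudoUnitary_blocks' (hT : T ∈ pseudoUnitary c d) :
    T.toBlocks₁₁ * T.toBlocks₁₁ᴴ = 1 + T.toBlocks₁₂ * T.toBlocks₁₂ᴴ ∧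
    T.toBlocks₂₂ * T.toBlocks₂₂ᴴ = 1 + T.toBlocks₂₁ * T.toBlocks₂₁ᴴ := by
  have h := pseudoUnitary_blocks (pseudoUnitary_conjTranspose hT)
  have e11 : Tᴴ.toBlocks₁₁ = T.toBlocks₁₁ᴴ := rfl
  have e12 : Tᴴ.toBlocks₁₂ = T.toBlocks₂₁ᴴ := rfl
  have e21 : Tᴴ.toBlocks₂₁ = T.toBlocks₁₂ᴴ := rfl
  have e22 : Tᴴ.toBlocks₂₂ = T.toBlocks₂₂ᴴ := rfl
  simp only [e11, e12, e21, e22, conjTranspose_conjTranspose] at h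
  exact ⟨h.1, h.2.2⟩

theorem det_ne_zero_of_conjTranspose_mul_self {n : Type*} [Fintype n] [DecidableEq n]
    {D K : Matrix n n ℂ} (hK : K.PosSemidef) (h : Dᴴ * D = 1 + K) : D.det ≠ 0 := by
  have hd : (1 + K).det ≠ 0 := (PosDef.one.add_posSemidef hK).det_pos.ne'
  intro h0
  rw [← h, det_mul, h0, mul_zero] at hd
  exact hd rfl

theorem det_toBlocks₂₂_ne_zero (hT : T ∈ pseudoUnitary c d) : T.toBlocks₂₂.det ≠ 0 :=
  det_ne_zero_of_conjTranspose_mul_self (posSemidef_conjTranspose_mul_self T.toBlocks₁₂)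
    (pseudoUnitary_blocks hT).2.2

theorem det_toBlocks₁₁_ne_zero (hT : T ∈ pseudoUnitary c d) : T.toBlocks₁₁.det ≠ 0 :=
  det_ne_zero_of_conjTranspose_mul_self (posSemidef_conjTranspose_mul_self T.toBlocks₂₁)
    (pseudoUnitary_blocks hT).1

/-- Sylvester's identity: `det (1 + C*C) = det (1 + CC*)`, where `A*A = 1 + C*C` and `DD* = 1 +
CC*`. -/
theorem det_conjTranspose_mul_toBlocks (hT : T ∈ pseudoUnitary c d) :
    (T.toBlocks₁₁ᴴ * T.toBlocks₁₁).det = (T.toBlocks₂₂ᴴ * T.toBlocks₂₂).det := by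
  rw [(pseudoUnitary_blocks hT).1, det_one_add_mul_comm, ← (pseudoUnitary_blocks' hT).2,
    det_mul_comm]

end

/-! ### Sums over sequences symmetric under inversion. -/

/-- As many values lie below `1` as above it. Since at least `|c - d|` values equal `1`, this common
number is at most `min c d`, so the cut at index `d` falls among the ones, where `f` vanishes. -/
theorem sum_range_eq_two_mul_of_inv_symm {c d : ℕ} {s : ℕ → ℝ} (hs : Antitone s)
    (hpos : ∀ i < c + d, 0 < s i)
    (hsymm : ∀ g : ℝ → ℝ, ∑ i ∈ Finset.range (c + d), g (s i)⁻¹ =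
      ∑ i ∈ Finset.range (c + d), g (s i))
    (hc : c ≤ d + ((Finset.range (c + d)).filter (s · = 1)).card)
    (hd : d ≤ c + ((Finset.range (c + d)).filter (s · = 1)).card)
    {f : ℝ → ℝ} (hf1 : f 1 = 0) (hf : ∀ x, f x⁻¹ = f x) :
    ∑ i ∈ Finset.range (c + d), f (s i) = 2 * ∑ i ∈ Finset.range d, f (s i) := by
  set R := Finset.range (c + d) with hR
  have h1 : ∑ i ∈ R, (if s i < 1 then f (s i) else 0) = ∑ i ∈ R, (if 1 < s i then f (s i) else 0) := by
    rw [← hsymm fun x => if x < 1 then f x else 0]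
    refine Finset.sum_congr rfl fun i hi => ?_
    have := hpos i (by simpa [hR] using hi)
    simp only [hf, inv_lt_one₀ this]
  have h2 : (R.filter (s · < 1)).card = (R.filter (1 < s ·)).card := by
    have : ((R.filter (s · < 1)).card : ℝ) = (R.filter (1 < s ·)).card := by
      rw [Finset.natCast_card_filter, Finset.natCast_card_filter,
        ← hsymm fun x => if x < 1 then 1 else 0]
      refine Finset.sum_congr rfl fun i hi => ?_
      have := hpos i (by simpa [hR] using hi)
      simp only [inv_lt_one₀ this]
    exact_mod_cast this
  have h3 : (R.filter (s · < 1)).card + (R.filter (s · = 1)).card + (R.filter (1 < s ·)).card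
      = c + d := by
    have hRc : R.card = c + d := Finset.card_range _
    rw [← hRc, ← Finset.card_union_of_disjoint, ← Finset.card_union_of_disjoint]
    · congr 1
      ext i
      simp only [Finset.mem_union, Finset.mem_filter]
      have := lt_trichotomy (s i) 1
      tauto
    · rw [Finset.disjoint_left]
      intro i
      simp only [Finset.mem_union, Finset.mem_filter, not_and, not_lt]
      rintro (h | h) - <;> linarith [h.2]
    · rw [Finset.disjoint_left]
      intro i
      simp only [Finset.mem_filter, not_and]
      exact fun h _ => h.2.ne
  -- A violation would give more than `d` values above `1`, against `hc`.
  have hgt : ∀ i ∈ R, d ≤ i → s i ≤ 1 := by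
    intro i hi hdi
    by_contra! h
    have : Finset.range (i + 1) ⊆ R.filter (1 < s ·) := by
      intro j hj
      simp only [hR, Finset.mem_filter, Finset.mem_range] at hj hi ⊢
      exact ⟨by omega, h.trans_le (hs (by omega))⟩
    have := Finset.card_le_card this
    rw [Finset.card_range] at this
    omega
  -- A violation would give more than `c` values below `1`, against `hd`.
  have hlt : ∀ i < d, 1 ≤ s i := by
    intro i hi
    by_contra! h
    have : Finset.Ico i (c + d) ⊆ R.filter (s · < 1) := by
      intro j hj
      simp only [hR, Finset.mem_filter, Finset.mem_range, Finset.mem_Ico] at hj ⊢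
      exact ⟨by omega, (hs hj.1).trans_lt h⟩
    have := Finset.card_le_card this
    rw [Nat.card_Ico] at this
    omega
  have hsum : ∑ i ∈ R, (if 1 < s i then f (s i) else 0) = ∑ i ∈ Finset.range d, f (s i) := by
    rw [← Finset.sum_subset (s₁ := Finset.range d)]
    · refine Finset.sum_congr rfl fun i hi => ?_
      rcases (hlt i (by simpa using hi)).lt_or_eq with h | h
      · rw [if_pos h]
      · rw [← h]; simp [hf1]
    · intro i hi
      simp only [hR, Finset.mem_range] at hi ⊢
      omega
    · intro i hi hi'
      rw [if_neg]
      simpa using hgt i hi (by simpa using hi')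
  calc ∑ i ∈ R, f (s i) = ∑ i ∈ R, ((if s i < 1 then f (s i) else 0) +
        (if 1 < s i then f (s i) else 0)) := by
        refine Finset.sum_congr rfl fun i _ => ?_
        rcases lt_trichotomy (s i) 1 with h | h | h
        · simp [h, h.le]
        · simp [h, hf1]
        · simp [h, h.le]
    _ = _ := by rw [Finset.sum_add_distrib, h1, hsum, two_mul]

/-! ### The determinant of `T*T + 1`. -/

section
variable {c d : ℕ} {T : Matrix (Fin c ⊕ Fin d) (Fin c ⊕ Fin d) ℂ}

theorem adjoint_comp_self_toEuclideanLin {m : Type*} [Fintype m] [DecidableEq m]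
    (T : Matrix m m ℂ) :
    LinearMap.adjoint T.toEuclideanLin ∘ₗ T.toEuclideanLin = (Tᴴ * T).toEuclideanLin := by
  rw [← Matrix.toEuclideanLin_conjTranspose_eq_adjoint]
  ext v i
  simp

/-- With `P = T*T` and `P⁻¹ = GPG`, the off-diagonal blocks cancel in `P + GPG`. The upper diagonal
block of `P + GPG + 2` is `2(A*A + C*C) + 2 = 4A*A`, and similarly below. -/
theorem gram_add_conj_add_two (hT : T ∈ pseudoUnitary c d) :
    (Tᴴ * T + 1) * (Tᴴ * T + 1) =
      Tᴴ * T * ((4 : ℂ) • fromBlocks (T.toBlocks₁₁ᴴ * T.toBlocks₁₁) 0 0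
        (T.toBlocks₂₂ᴴ * T.toBlocks₂₂)) := by
  have hP : Tᴴ * T * signatureForm c d * (Tᴴ * T) = signatureForm c d := by
    have h := pseudoUnitary_mul (pseudoUnitary_conjTranspose hT) hT
    simpa [pseudoUnitary] using h
  have hb : Tᴴ * T + signatureForm c d * (Tᴴ * T) * signatureForm c d + 2 =
      (4 : ℂ) • fromBlocks (T.toBlocks₁₁ᴴ * T.toBlocks₁₁) 0 0
        (T.toBlocks₂₂ᴴ * T.toBlocks₂₂) := by
    obtain ⟨h1, -, h2⟩ := pseudoUnitary_blocks hT
    have e : (2 : Matrix (Fin c ⊕ Fin d) (Fin c ⊕ Fin d) ℂ) = fromBlocks (1 + 1) 0 0 (1 + 1) := by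
      rw [← one_add_one_eq_two, ← fromBlocks_one, fromBlocks_add, add_zero, add_zero]
    have h1' : T.toBlocks₂₁ᴴ * T.toBlocks₂₁ = T.toBlocks₁₁ᴴ * T.toBlocks₁₁ - 1 := by rw [h1]; abel
    have h2' : T.toBlocks₁₂ᴴ * T.toBlocks₁₂ = T.toBlocks₂₂ᴴ * T.toBlocks₂₂ - 1 := by rw [h2]; abel
    rw [← fromBlocks_toBlocks T, e]
    simp only [signatureForm, fromBlocks_conjTranspose, fromBlocks_multiply, fromBlocks_add,
      fromBlocks_smul, toBlocks_fromBlocks₁₁, toBlocks_fromBlocks₂₂, Matrix.mul_one,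
      Matrix.mul_zero, add_zero, zero_add, Matrix.mul_neg, Matrix.neg_mul, Matrix.one_mul,
      Matrix.zero_mul, fromBlocks_inj, h1', h2', neg_neg]
    refine ⟨?_, ?_, ?_, ?_⟩
    · module
    · simp
    · simp
    · module
  rw [← hb]
  have : Tᴴ * T * (signatureForm c d * (Tᴴ * T) * signatureForm c d) = 1 := by
    rw [← Matrix.mul_assoc, ← Matrix.mul_assoc, hP, signatureForm_mul_self]
  rw [mul_add (Tᴴ * T), mul_add (Tᴴ * T), this]
  noncomm_ring

theorem det_gram (hT : T ∈ pseudoUnitary c d) : (Tᴴ * T).det = 1 := by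
  have h : Tᴴ * signatureForm c d * T = signatureForm c d := hT
  have hG : (signatureForm c d).det * (signatureForm c d).det = 1 := by
    rw [← det_mul, signatureForm_mul_self, det_one]
  apply_fun det at h
  rw [det_mul, det_mul] at h
  rw [det_mul]
  have h0 : (signatureForm c d).det ≠ 0 := left_ne_zero_of_mul_eq_one hG
  apply mul_right_cancel₀ h0
  rw [one_mul, ← h]; rw [h]; linear_combination h

theorem det_gram_add_one (hT : T ∈ pseudoUnitary c d) :
    (Tᴴ * T + 1).det ^ 2 = 4 ^ (c + d) * (‖T.toBlocks₂₂.det‖ : ℂ) ^ 4 := by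
  have h := congrArg det (gram_add_conj_add_two hT)
  rw [det_mul, det_mul, det_gram hT, det_smul, det_fromBlocks_zero₂₁,
    det_conjTranspose_mul_toBlocks hT, det_mul, det_conjTranspose, Complex.star_def,
    Complex.conj_mul'] at h
  rw [sq, h]
  simp
  ring

end

/-! ### Singular values, and `N_d` as `log |det D|`. -/

section
variable {c d : ℕ} {T : Matrix (Fin c ⊕ Fin d) (Fin c ⊕ Fin d) ℂ}

/-- From `PGP = G`, the involution `G` carries the `μ`-eigenspace of `P` into the `μ⁻¹`-eigenspace.
-/
theorem finrank_eigenspace_gram_le_inv (hT : T ∈ pseudoUnitary c d) (μ : ℂ) :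
    Module.finrank ℂ (Module.End.eigenspace (Tᴴ * T).toEuclideanLin μ) ≤
      Module.finrank ℂ (Module.End.eigenspace (Tᴴ * T).toEuclideanLin μ⁻¹) := by
  rcases eq_or_ne μ 0 with rfl | hμ
  · rw [_root_.inv_zero]
  have hP : Tᴴ * T * signatureForm c d * (Tᴴ * T) = signatureForm c d := by
    have h := pseudoUnitary_mul (pseudoUnitary_conjTranspose hT) hT
    simpa [pseudoUnitary] using h
  have hmaps : ∀ v ∈ Module.End.eigenspace (Tᴴ * T).toEuclideanLin μ,
      (signatureForm c d).toEuclideanLin v ∈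
        Module.End.eigenspace (Tᴴ * T).toEuclideanLin μ⁻¹ := by
    intro v hv
    rw [Module.End.mem_eigenspace_iff] at hv ⊢
    have hv' : (Tᴴ * T) *ᵥ v.ofLp = μ • v.ofLp := congrArg WithLp.ofLp hv
    have h := congrArg (· *ᵥ v.ofLp) hP
    simp only [← Matrix.mulVec_mulVec, hv', Matrix.mulVec_smul] at h
    have h' : (Tᴴ * T) *ᵥ (signatureForm c d *ᵥ v.ofLp) = μ⁻¹ • (signatureForm c d *ᵥ v.ofLp) := by
      rw [eq_inv_smul_iff₀ hμ]
      simpa only [Matrix.mulVec_mulVec, Matrix.mul_assoc] using h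
    exact congrArg (WithLp.toLp 2) h'
  refine LinearMap.finrank_le_finrank_of_injective (f := LinearMap.restrict _ hmaps) ?_
  intro v w h
  have h1 : signatureForm c d *ᵥ v.1.ofLp = signatureForm c d *ᵥ w.1.ofLp :=
    congrArg WithLp.ofLp (congrArg Subtype.val h)
  have h2 := congrArg (signatureForm c d *ᵥ ·) h1
  simp only [Matrix.mulVec_mulVec, signatureForm_mul_self, Matrix.one_mulVec] at h2
  exact Subtype.ext (WithLp.ofLp_injective 2 h2)

theorem finrank_eigenspace_gram_inv (hT : T ∈ pseudoUnitary c d) (μ : ℂ) :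
    Module.finrank ℂ (Module.End.eigenspace (Tᴴ * T).toEuclideanLin μ⁻¹) =
      Module.finrank ℂ (Module.End.eigenspace (Tᴴ * T).toEuclideanLin μ) := by
  refine le_antisymm ?_ (finrank_eigenspace_gram_le_inv hT μ)
  have h := finrank_eigenspace_gram_le_inv hT μ⁻¹
  rwa [inv_inv] at h

/-- Kernels of the off-diagonal blocks supply the singular values equal to `1` that the difference
of `c` and `d` forces. -/
theorem gram_mulVec_of_toBlocks₂₁ (hT : T ∈ pseudoUnitary c d) {x : Fin c → ℂ}
    (hx : T.toBlocks₂₁ *ᵥ x = 0) : (Tᴴ * T) *ᵥ Sum.elim x 0 = Sum.elim x 0 := by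
  obtain ⟨h1, h2, -⟩ := pseudoUnitary_blocks hT
  have h2' : T.toBlocks₁₂ᴴ * T.toBlocks₁₁ = T.toBlocks₂₂ᴴ * T.toBlocks₂₁ := by
    simpa using congrArg conjTranspose h2
  rw [← fromBlocks_toBlocks T, fromBlocks_conjTranspose, fromBlocks_multiply, fromBlocks_mulVec]
  simp only [Sum.elim_comp_inl, Sum.elim_comp_inr, mulVec_zero, add_zero, h1, h2',
    add_mulVec, ← mulVec_mulVec, hx, one_mulVec]

theorem gram_mulVec_of_toBlocks₁₂ (hT : T ∈ pseudoUnitary c d) {x : Fin d → ℂ}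
    (hx : T.toBlocks₁₂ *ᵥ x = 0) : (Tᴴ * T) *ᵥ Sum.elim (0 : Fin c → ℂ) x = Sum.elim (0 : Fin c → ℂ) x := by
  obtain ⟨-, h2, h1⟩ := pseudoUnitary_blocks hT
  rw [← fromBlocks_toBlocks T, fromBlocks_conjTranspose, fromBlocks_multiply, fromBlocks_mulVec]
  simp only [Sum.elim_comp_inl, Sum.elim_comp_inr, mulVec_zero, add_zero, zero_add, h1, ← h2,
    add_mulVec, ← mulVec_mulVec, hx, one_mulVec]

/-- Rank-nullity: the kernel of `C` has dimension at least `m - n`, and `g` embeds it into the fixed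
vectors of `P`. -/
theorem le_add_finrank_eigenspace_gram_one {m n : ℕ} {p : Type*} [Fintype p] [DecidableEq p]
    {P : Matrix p p ℂ} (C : Matrix (Fin n) (Fin m) ℂ) (g : (Fin m → ℂ) →ₗ[ℂ] (p → ℂ))
    (hg : Function.Injective g) (h : ∀ x, C *ᵥ x = 0 → P *ᵥ g x = g x) :
    m ≤ n + Module.finrank ℂ (Module.End.eigenspace P.toEuclideanLin 1) := by
  have h1 := (Matrix.toLin' C).finrank_range_add_finrank_ker
  have h2 := (LinearMap.range (Matrix.toLin' C)).finrank_le
  have h1' : Module.finrank ℂ (Fin m → ℂ) = m := by simp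
  have hmaps : ∀ x ∈ LinearMap.ker (Matrix.toLin' C),
      ((WithLp.linearEquiv 2 ℂ (p → ℂ)).symm.toLinearMap ∘ₗ g) x ∈
        Module.End.eigenspace P.toEuclideanLin 1 := by
    intro x hx
    rw [Module.End.mem_eigenspace_iff, one_smul]
    exact congrArg (WithLp.toLp 2) (h x hx)
  have h3 := LinearMap.finrank_le_finrank_of_injective (f := LinearMap.restrict _ hmaps) (by
    intro v w h
    have h1 : g v.1 = g w.1 := congrArg WithLp.ofLp (congrArg Subtype.val h)
    exact Subtype.ext (hg h1))
  have h2' : Module.finrank ℂ (Fin n → ℂ) = n := by simp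
  rw [h1'] at h1
  rw [h2'] at h2
  refine le_trans ?_ (Nat.add_le_add_left h3 n)
  omega

theorem finrank_eigenspace_gram_one (hT : T ∈ pseudoUnitary c d) :
    c ≤ d + Module.finrank ℂ (Module.End.eigenspace (Tᴴ * T).toEuclideanLin 1) ∧
    d ≤ c + Module.finrank ℂ (Module.End.eigenspace (Tᴴ * T).toEuclideanLin 1) := by
  constructor
  · refine le_add_finrank_eigenspace_gram_one T.toBlocks₂₁
      ((LinearEquiv.sumArrowLequivProdArrow _ _ ℂ ℂ).symm.toLinearMap ∘ₗ LinearMap.inl ℂ _ _) ?_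
      fun x hx => gram_mulVec_of_toBlocks₂₁ hT hx
    rw [LinearMap.coe_comp]
    exact (LinearEquiv.injective (LinearEquiv.sumArrowLequivProdArrow _ _ ℂ ℂ).symm).comp
      LinearMap.inl_injective
  · refine le_add_finrank_eigenspace_gram_one T.toBlocks₁₂
      ((LinearEquiv.sumArrowLequivProdArrow _ _ ℂ ℂ).symm.toLinearMap ∘ₗ LinearMap.inr ℂ _ _) ?_
      fun x hx => gram_mulVec_of_toBlocks₁₂ hT hx
    rw [LinearMap.coe_comp]
    exact (LinearEquiv.injective (LinearEquiv.sumArrowLequivProdArrow _ _ ℂ ℂ).symm).comp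
      LinearMap.inr_injective

theorem card_filter_sq_singularValues (T : Matrix (Fin c ⊕ Fin d) (Fin c ⊕ Fin d) ℂ) (μ : ℝ) :
    ((Finset.range (c + d)).filter fun i => T.toEuclideanLin.singularValues i ^ 2 = μ).card =
      Module.finrank ℂ (Module.End.eigenspace (Tᴴ * T).toEuclideanLin (μ : ℂ)) := by
  have hn : Module.finrank ℂ (EuclideanSpace ℂ (Fin c ⊕ Fin d)) = c + d := by simp
  have h := T.toEuclideanLin.isSymmetric_adjoint_comp_self.card_filter_eigenvalues_eq hn (μ : ℂ)
  rw [← adjoint_comp_self_toEuclideanLin, ← h, Finset.card_filter, Finset.card_filter, Finset.sum_range]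
  refine Finset.sum_congr rfl fun i _ => ?_
  rw [LinearMap.sq_singularValues_fin _ hn]
  simp

theorem singularValues_pos_of_mem_pseudoUnitary (hT : T ∈ pseudoUnitary c d) {i : ℕ}
    (hi : i < c + d) : 0 < T.toEuclideanLin.singularValues i := by
  have hdet : IsUnit T.det := by
    have := det_gram hT
    rw [det_mul] at this
    exact IsUnit.of_mul_eq_one_right _ this
  refine T.toEuclideanLin.injective_iff_forall_lt_finrank_singularValues_pos.mp ?_ i (by simpa)
  intro v w h
  have h1 : T *ᵥ v.ofLp = T *ᵥ w.ofLp := congrArg WithLp.ofLp h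
  exact WithLp.ofLp_injective 2 (Matrix.mulVec_injective_of_isUnit
    ((Matrix.isUnit_iff_isUnit_det _).mpr hdet) h1)

/-- Multiplicities of positive singular values are eigenspace dimensions of `T*T` at their squares,
so the multiset of singular values is stable under inversion. -/
theorem sum_singularValues_inv (hT : T ∈ pseudoUnitary c d) (g : ℝ → ℝ) :
    ∑ i ∈ Finset.range (c + d), g (T.toEuclideanLin.singularValues i)⁻¹ =
      ∑ i ∈ Finset.range (c + d), g (T.toEuclideanLin.singularValues i) := by
  set s := T.toEuclideanLin.singularValues
  have hmul : (Finset.range (c + d)).val.map (fun i => (s i)⁻¹) =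
      (Finset.range (c + d)).val.map (fun i => s i) := by
    ext μ
    rw [Multiset.count_map, Multiset.count_map]
    change ((Finset.range (c + d)).filter fun i => μ = (s i)⁻¹).card =
      ((Finset.range (c + d)).filter fun i => μ = s i).card
    rcases le_or_gt μ 0 with hμ | hμ
    · rw [Finset.filter_false_of_mem, Finset.filter_false_of_mem]
      · intro i hi
        have := singularValues_pos_of_mem_pseudoUnitary hT (Finset.mem_range.mp hi)
        exact (hμ.trans_lt this).ne
      · intro i hi
        have := singularValues_pos_of_mem_pseudoUnitary hT (Finset.mem_range.mp hi)
        exact (hμ.trans_lt (inv_pos.mpr this)).ne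
    · have h1 := card_filter_sq_singularValues T (μ ^ 2)
      have h2 := card_filter_sq_singularValues T (μ⁻¹ ^ 2)
      rw [show (((μ⁻¹ ^ 2 : ℝ)) : ℂ) = ((μ ^ 2 : ℝ) : ℂ)⁻¹ by push_cast; rw [inv_pow],
        finrank_eigenspace_gram_inv hT, ← h1] at h2
      have e1 : ∀ i, μ = (s i)⁻¹ ↔ s i ^ 2 = μ⁻¹ ^ 2 := fun i => by
        rw [pow_left_inj₀ (T.toEuclideanLin.singularValues_nonneg i) (inv_pos.mpr hμ).le two_ne_zero,
          eq_comm, inv_eq_iff_eq_inv]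
      have e2 : ∀ i, μ = s i ↔ s i ^ 2 = μ ^ 2 := fun i => by
        rw [pow_left_inj₀ (T.toEuclideanLin.singularValues_nonneg i) hμ.le two_ne_zero, eq_comm]
      simp only [e1, e2]
      exact h2
  have := congrArg (fun m : Multiset ℝ => (m.map g).sum) hmul
  simpa [Multiset.map_map, Finset.sum] using this

open Polynomial in
theorem charpoly_gram (T : Matrix (Fin c ⊕ Fin d) (Fin c ⊕ Fin d) ℂ) :
    (Tᴴ * T).charpoly = ∏ i ∈ Finset.range (c + d),
      (X - C ((T.toEuclideanLin.singularValues i ^ 2 : ℝ) : ℂ)) := by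
  have hn : Module.finrank ℂ (EuclideanSpace ℂ (Fin c ⊕ Fin d)) = c + d := by simp
  have h := T.toEuclideanLin.isSymmetric_adjoint_comp_self.charpoly_eq hn
  rw [Finset.prod_range]
  simp_rw [LinearMap.sq_singularValues_fin _ hn]
  refine Eq.trans ?_ h
  rw [adjoint_comp_self_toEuclideanLin, toEuclideanLin_eq_toLin_orthonormal, charpoly_toLin]

/-- Evaluation of the characteristic polynomial of `T*T` at `-1`. -/
theorem prod_sq_singularValues_add_one (T : Matrix (Fin c ⊕ Fin d) (Fin c ⊕ Fin d) ℂ) :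
    ((∏ i ∈ Finset.range (c + d), (T.toEuclideanLin.singularValues i ^ 2 + 1) : ℝ) : ℂ) =
      (Tᴴ * T + 1).det := by
  have h := congrArg (Polynomial.eval (-1)) (charpoly_gram T)
  have hneg : scalar (Fin c ⊕ Fin d) (-1 : ℂ) - Tᴴ * T = -(Tᴴ * T + 1) := by
    rw [map_neg, map_one]; abel
  rw [Matrix.eval_charpoly, hneg, det_neg, Polynomial.eval_prod] at h
  simp only [Polynomial.eval_sub, Polynomial.eval_X, Polynomial.eval_C] at h
  have h2 : ∀ i, (-1 : ℂ) - ((T.toEuclideanLin.singularValues i ^ 2 : ℝ) : ℂ) =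
      -1 * ((T.toEuclideanLin.singularValues i ^ 2 + 1 : ℝ) : ℂ) := by
    intro i; push_cast; ring
  simp_rw [h2] at h
  rw [Finset.prod_mul_distrib, Finset.prod_const, Finset.card_range, Fintype.card_sum,
    Fintype.card_fin, Fintype.card_fin] at h
  rw [Complex.ofReal_prod]
  exact (mul_left_cancel₀ (pow_ne_zero _ (by norm_num)) h).symm

theorem prod_singularValues (hT : T ∈ pseudoUnitary c d) :
    ∏ i ∈ Finset.range (c + d), T.toEuclideanLin.singularValues i = 1 := by
  have hpos := fun i (hi : i ∈ Finset.range (c + d)) =>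
    singularValues_pos_of_mem_pseudoUnitary hT (Finset.mem_range.mp hi)
  have h := sum_singularValues_inv hT Real.log
  simp only [Real.log_inv, Finset.sum_neg_distrib] at h
  have h0 : ∑ i ∈ Finset.range (c + d), Real.log (T.toEuclideanLin.singularValues i) = 0 := by
    linarith
  rw [← Real.log_prod fun i hi => (hpos i hi).ne'] at h0
  exact Real.eq_one_of_pos_of_log_eq_zero (Finset.prod_pos hpos) h0

theorem sumLogCosh_eq_log_norm_det (hT : T ∈ pseudoUnitary c d) :
    sumLogCosh d T = Real.log ‖T.toBlocks₂₂.det‖ := by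
  have hpos := fun i hi => singularValues_pos_of_mem_pseudoUnitary (i := i) hT hi
  have hone : ((Finset.range (c + d)).filter fun i => T.toEuclideanLin.singularValues i = 1).card =
      Module.finrank ℂ (Module.End.eigenspace (Tᴴ * T).toEuclideanLin (1 : ℂ)) := by
    have := card_filter_sq_singularValues T 1
    rw [Complex.ofReal_one] at this
    rw [← this]
    congr 2
    ext i
    rw [pow_eq_one_iff_of_nonneg (T.toEuclideanLin.singularValues_nonneg i) two_ne_zero]
  have h := sum_range_eq_two_mul_of_inv_symm (f := fun x => Real.log ((x + x⁻¹) / 2))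
    T.toEuclideanLin.singularValues_antitone
    hpos (sum_singularValues_inv hT) (by rw [hone]; exact (finrank_eigenspace_gram_one hT).1)
    (by rw [hone]; exact (finrank_eigenspace_gram_one hT).2) (by norm_num)
    (fun x => by simp only [inv_inv, add_comm])
  -- One factor `2` comes from summing over all singular values, the other from the square in
  -- `det_gram_add_one`.
  have h2 : 2 * (2 * sumLogCosh d T) = 4 * Real.log ‖T.toBlocks₂₂.det‖ := by
    rw [sumLogCosh, ← h]
    set s := T.toEuclideanLin.singularValues with hs
    have h3 := prod_sq_singularValues_add_one T
    have h4 := det_gram_add_one hT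
    rw [← h3] at h4
    have h5 : (∏ i ∈ Finset.range (c + d), (s i ^ 2 + 1)) ^ 2 =
      4 ^ (c + d) * ‖T.toBlocks₂₂.det‖ ^ 4 := by exact_mod_cast h4
    have h6 : (∏ i ∈ Finset.range (c + d), ((s i + (s i)⁻¹) / 2)) ^ 2 = ‖T.toBlocks₂₂.det‖ ^ 4 := by
      have : ∏ i ∈ Finset.range (c + d), ((s i + (s i)⁻¹) / 2) =
          (∏ i ∈ Finset.range (c + d), (s i ^ 2 + 1)) / (∏ i ∈ Finset.range (c + d), s i) /
            2 ^ (c + d) := by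
        rw [← Finset.prod_div_distrib, ← Finset.card_range (c + d), ← Finset.prod_const,
          Finset.card_range, ← Finset.prod_div_distrib]
        refine Finset.prod_congr rfl fun i hi => ?_
        have := (hpos i (Finset.mem_range.mp hi)).ne'
        field_simp
      rw [this, prod_singularValues hT, div_one, div_pow, h5, ← pow_mul, mul_comm _ 2, pow_mul]
      norm_num
    have h7 : ∀ i ∈ Finset.range (c + d), (s i + (s i)⁻¹) / 2 ≠ 0 := by
      intro i hi
      have := hpos i (Finset.mem_range.mp hi)
      positivity
    rw [← Real.log_prod h7]
    have := congrArg Real.log h6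
    rw [Real.log_pow, Real.log_pow] at this
    exact_mod_cast this
  linarith

end

/-! ### Bounds for minors of pseudo-unitary matrices. -/

theorem norm_entry_le_one_of_mul_conjTranspose_add {m n : Type*} [Fintype m] [Fintype n]
    [DecidableEq m] {X : Matrix m n ℂ} {K : Matrix m m ℂ} (hK : K.PosSemidef)
    (h : X * Xᴴ + K = 1) (i : m) (j : n) : ‖X i j‖ ≤ 1 := by
  have h1 := congrFun (congrFun h i) i
  have h2 : 0 ≤ K i i := hK.diag_nonneg
  have h3 : (X * Xᴴ) i i = ((∑ l, ‖X i l‖ ^ 2 : ℝ) : ℂ) := by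
    rw [Matrix.mul_apply, Complex.ofReal_sum]
    refine Finset.sum_congr rfl fun l _ => ?_
    rw [conjTranspose_apply, Complex.star_def, Complex.mul_conj']
    push_cast
    rfl
  rw [Matrix.add_apply, h3, one_apply_eq] at h1
  have h4 : ∑ l, ‖X i l‖ ^ 2 ≤ 1 := by
    have := congrArg Complex.re h1
    rw [Complex.add_re, Complex.ofReal_re, Complex.one_re] at this
    have h5 : 0 ≤ (K i i).re := (Complex.le_def.mp h2).1
    linarith
  have h5 : ‖X i j‖ ^ 2 ≤ ∑ l, ‖X i l‖ ^ 2 :=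
    Finset.single_le_sum (f := fun l => ‖X i l‖ ^ 2) (fun _ _ => by positivity) (Finset.mem_univ j)
  exact (sq_le_one_iff₀ (norm_nonneg _)).mp (h5.trans h4)

/-- Conjugating the hypothesis by `X⁻¹` gives `X⁻¹X⁻¹* + (X⁻¹Y)(X⁻¹Y)* = 1`, so all rows of both
matrices have norm at most `1`. -/
theorem norm_inv_entry_le_one {m n : Type*} [Fintype m] [Fintype n] [DecidableEq m]
    {X : Matrix m m ℂ} {Y : Matrix m n ℂ} (h : X * Xᴴ = 1 + Y * Yᴴ) (hX : X.det ≠ 0) :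
    (∀ i j, ‖X⁻¹ i j‖ ≤ 1) ∧ ∀ i j, ‖(X⁻¹ * Y) i j‖ ≤ 1 := by
  have hu : IsUnit X.det := isUnit_iff_ne_zero.mpr hX
  have hu' : IsUnit Xᴴ.det := by rw [det_conjTranspose]; exact hu.star
  have key : X⁻¹ * X⁻¹ᴴ + (X⁻¹ * Y) * (X⁻¹ * Y)ᴴ = 1 := by
    have : X⁻¹ * (X * Xᴴ) * X⁻¹ᴴ = 1 := by
      rw [nonsing_inv_mul_cancel_left _ _ hu, conjTranspose_nonsing_inv, mul_nonsing_inv _ hu']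
    rw [h] at this
    rw [← this, conjTranspose_mul]
    simp only [Matrix.mul_add, Matrix.add_mul, Matrix.mul_assoc, Matrix.one_mul]
  refine ⟨norm_entry_le_one_of_mul_conjTranspose_add (posSemidef_self_mul_conjTranspose (X⁻¹ * Y)) key,
    norm_entry_le_one_of_mul_conjTranspose_add (posSemidef_self_mul_conjTranspose X⁻¹) ?_⟩
  rw [add_comm]
  exact key

theorem norm_det_le {n : Type*} [Fintype n] [DecidableEq n] {A : Matrix n n ℂ} {x : ℝ}
    (h : ∀ i j, ‖A i j‖ ≤ x) :
    ‖A.det‖ ≤ (Fintype.card n).factorial * x ^ Fintype.card n := by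
  rw [← nsmul_eq_mul]
  exact Matrix.det_le (abv := NormedField.toAbsoluteValue ℂ) h

theorem norm_det_le_factorial {n : Type*} [Fintype n] [DecidableEq n] {A : Matrix n n ℂ}
    (h : ∀ i j, ‖A i j‖ ≤ 1) : ‖A.det‖ ≤ (Fintype.card n).factorial := by
  simpa using norm_det_le h

section
variable {c d : ℕ} {T : Matrix (Fin c ⊕ Fin d) (Fin c ⊕ Fin d) ℂ}

theorem one_le_factorial_mul_norm_det_toBlocks₂₂ (hT : T ∈ pseudoUnitary c d) :
    1 ≤ d.factorial * ‖T.toBlocks₂₂.det‖ := by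
  have hD := det_toBlocks₂₂_ne_zero hT
  have h := norm_det_le_factorial (norm_inv_entry_le_one (pseudoUnitary_blocks' hT).2 hD).1
  rw [det_nonsing_inv, Ring.inverse_eq_inv', norm_inv, Fintype.card_fin] at h
  have hpos : 0 < ‖T.toBlocks₂₂.det‖ := norm_pos_iff.mpr hD
  calc (1 : ℝ) = ‖T.toBlocks₂₂.det‖⁻¹ * ‖T.toBlocks₂₂.det‖ := (inv_mul_cancel₀ hpos.ne').symm
    _ ≤ _ := by gcongr

/-- Every minor of size `d` of a matrix in `U(c, d)` is controlled by its lower right one. -/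
theorem norm_det_submatrix_le (hT : T ∈ pseudoUnitary c d) (r q : Fin d → Fin c ⊕ Fin d) :
    ‖(T.submatrix r q).det‖ ≤ (2 * d).factorial * ‖T.toBlocks₂₂.det‖ := by
  set A := T.toBlocks₁₁
  set B := T.toBlocks₁₂
  set C := T.toBlocks₂₁
  set D := T.toBlocks₂₂
  have hD : D.det ≠ 0 := det_toBlocks₂₂_ne_zero hT
  have hDu : IsUnit D.det := isUnit_iff_ne_zero.mpr hD
  have hA : Aᴴ.det ≠ 0 := by
    rw [det_conjTranspose]; exact star_ne_zero.mpr (det_toBlocks₁₁_ne_zero hT)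
  have hDh : Dᴴ.det ≠ 0 := by rw [det_conjTranspose]; exact star_ne_zero.mpr hD
  obtain ⟨hA1, hAB, hD1⟩ := pseudoUnitary_blocks hT
  obtain ⟨hDi, hDiC⟩ := norm_inv_entry_le_one (pseudoUnitary_blocks' hT).2 hD
  have hS := (norm_inv_entry_le_one (X := Aᴴ) (Y := Cᴴ)
    (by rw [conjTranspose_conjTranspose, conjTranspose_conjTranspose]; exact hA1) hA).1
  have hBDi : ∀ i j, ‖(B * D⁻¹) i j‖ ≤ 1 := by
    intro i j
    have := (norm_inv_entry_le_one (X := Dᴴ) (Y := Bᴴ)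
      (by rw [conjTranspose_conjTranspose, conjTranspose_conjTranspose]; exact hD1) hDh).2 j i
    rwa [← conjTranspose_nonsing_inv, ← conjTranspose_mul, conjTranspose_apply, norm_star] at this
  -- The Schur complement `A - BD⁻¹C` equals `(A*)⁻¹`, whose entries are bounded by `1`.
  have hSeq : Aᴴ⁻¹ + B * D⁻¹ * C = A := by
    rw [← eq_sub_iff_add_eq]
    refine inv_eq_right_inv ?_
    rw [Matrix.mul_sub, ← Matrix.mul_assoc, ← Matrix.mul_assoc, hAB,
      mul_nonsing_inv_cancel_right _ _ hDu, hA1]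
    abel
  set X : Matrix (Fin c ⊕ Fin d) (Fin c ⊕ Fin d) ℂ := fromBlocks Aᴴ⁻¹ 0 0 0 with hX
  set E : Matrix (Fin c ⊕ Fin d) (Fin d) ℂ := fromRows (B * D⁻¹) 1 with hE
  set F : Matrix (Fin d) (Fin c ⊕ Fin d) ℂ := fromCols (D⁻¹ * C) 1 with hF
  have hdecomp : T = X + E * D * F := by
    rw [← fromBlocks_toBlocks T, hX, hE, hF, fromRows_mul, fromRows_mul_fromCols, fromBlocks_add]
    simp only [Matrix.mul_one, Matrix.one_mul, zero_add, Matrix.mul_assoc,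
      mul_nonsing_inv_cancel_left _ _ hDu, nonsing_inv_mul _ hDu]
    rw [← Matrix.mul_assoc B, hSeq]
  have hXe : ∀ i j, ‖X i j‖ ≤ 1 := by
    rintro (i | i) (j | j) <;> simp [hX, hS]
  have hone : ∀ i j, ‖(1 : Matrix (Fin d) (Fin d) ℂ) i j‖ ≤ 1 := by
    intro i j; rw [one_apply]; split_ifs <;> simp
  have hEe : ∀ i j, ‖E i j‖ ≤ 1 := by
    rintro (i | i) j
    · simpa [hE] using hBDi i j
    · simpa [hE] using hone i j
  have hFe : ∀ i j, ‖F i j‖ ≤ 1 := by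
    rintro i (j | j)
    · simpa [hF] using hDiC i j
    · simpa [hF] using hone i j
  have hsub : T.submatrix r q = X.submatrix r q - E.submatrix r id * D * -(F.submatrix id q) := by
    rw [Matrix.mul_neg, sub_neg_eq_add]
    conv_lhs => rw [hdecomp]
    ext i j
    simp [Matrix.mul_apply]
  let : Invertible D⁻¹ := invertibleOfRightInverse D⁻¹ D (nonsing_inv_mul D hDu)
  have hinv : ⅟(D⁻¹) = D := rfl
  -- The minor of `X + EDF`, divided by `det D`, is itself a determinant of size `2d` with entries
  -- bounded by `1`; hence the constant `(2d)!`.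
  have hdet := det_fromBlocks₁₁ D⁻¹ (-(F.submatrix id q)) (E.submatrix r id) (X.submatrix r q)
  rw [hinv, ← hsub, det_nonsing_inv, Ring.inverse_eq_inv'] at hdet
  have hbound := norm_det_le_factorial
    (A := fromBlocks D⁻¹ (-(F.submatrix id q)) (E.submatrix r id) (X.submatrix r q)) (by
      rintro (i | i) (j | j)
      · exact hDi i j
      · simpa using hFe i (q j)
      · simpa using hEe (r i) j
      · simpa using hXe (r i) (q j))
  rw [hdet, norm_mul, norm_inv, Fintype.card_sum, Fintype.card_fin, ← two_mul] at hbound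
  have hpos : 0 < ‖D.det‖ := norm_pos_iff.mpr hD
  calc ‖(T.submatrix r q).det‖ = ‖D.det‖⁻¹ * ‖(T.submatrix r q).det‖ * ‖D.det‖ := by field_simp
    _ ≤ _ := by gcongr

end

/-! ### Growth rates, spectral radius and exterior powers. -/

theorem matrix_linfty_opNorm_le {κ : Type*} [Fintype κ] {M : Matrix κ κ ℂ} {x : ℝ} (hx : 0 ≤ x)
    (h : ∀ i j, ‖M i j‖ ≤ x) :
    letI := Matrix.linftyOpNormedAddCommGroup (m := κ) (n := κ) (α := ℂ)
    ‖M‖ ≤ Fintype.card κ * x := by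
  let := Matrix.linftyOpNormedAddCommGroup (m := κ) (n := κ) (α := ℂ)
  show ‖M‖ ≤ Fintype.card κ * x
  lift x to NNReal using hx
  rw [Matrix.linfty_opNorm_def]
  have : (Finset.univ : Finset κ).sup (fun i => ∑ j, ‖M i j‖₊) ≤ Fintype.card κ * x := by
    refine Finset.sup_le fun i _ => ?_
    calc ∑ j, ‖M i j‖₊ ≤ ∑ j : κ, x := Finset.sum_le_sum fun j _ => h i j
      _ = _ := by simp
  exact_mod_cast this

/-- If the powers of an element of a complex Banach algebra have norms comparable to a sequence
bounded away from `0`, then the exponential growth rate of the sequence is the logarithm of the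
spectral radius. -/
theorem tendsto_log_div_of_norm_pow_comparable {A : Type*} [NormedRing A] [NormedAlgebra ℂ A]
    [CompleteSpace A] (x : A) {a : ℕ → ℝ} {δ C₁ C₂ : ℝ} (hδ : 0 < δ) (hC₁ : 0 < C₁) (hC₂ : 0 < C₂)
    (hδa : ∀ k, δ ≤ a k) (h₁ : ∀ k, a k ≤ C₁ * ‖x ^ k‖) (h₂ : ∀ k, ‖x ^ k‖ ≤ C₂ * a k) :
    Tendsto (fun k : ℕ => (k : ℝ)⁻¹ * Real.log (a k)) atTop
      (𝓝 (Real.log (spectralRadius ℂ x).toReal)) := by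
  have hpos : ∀ k, 0 < a k := fun k => hδ.trans_le (hδa k)
  have hN : ∀ k, δ / C₁ ≤ ‖x ^ k‖ := fun k => by
    rw [div_le_iff₀' hC₁]; exact (hδa k).trans (h₁ k)
  have hNpos : ∀ k, 0 < ‖x ^ k‖ := fun k => (div_pos hδ hC₁).trans_le (hN k)
  have hinv : Tendsto (fun k : ℕ => (k : ℝ)⁻¹) atTop (𝓝 0) := tendsto_inv_atTop_nhds_zero_nat
  have hfin : spectralRadius ℂ x ≠ ⊤ := by
    have := spectrum.spectralRadius_le_pow_nnnorm_pow_one_div ℂ x 0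
    refine ne_top_of_le_ne_top ?_ this
    simp [ENNReal.mul_eq_top]
  have hlim : Tendsto (fun k : ℕ => ‖x ^ k‖ ^ (1 / k : ℝ)) atTop
      (𝓝 (spectralRadius ℂ x).toReal) := by
    have := (ENNReal.tendsto_toReal hfin).comp
      (spectrum.pow_norm_pow_one_div_tendsto_nhds_spectralRadius x)
    refine this.congr fun k => ?_
    exact ENNReal.toReal_ofReal (by positivity)
  -- Only positivity is needed, for continuity of `log` at the limit.
  have hone : 1 ≤ (spectralRadius ℂ x).toReal := by
    have h0 : Tendsto (fun k : ℕ => (δ / C₁) ^ (1 / k : ℝ)) atTop (𝓝 1) := by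
      have := (Real.continuousAt_const_rpow (a := δ / C₁) (b := 0) (div_pos hδ hC₁).ne').tendsto.comp
        hinv
      simpa [Function.comp_def] using this
    refine le_of_tendsto_of_tendsto' h0 hlim fun k => ?_
    have := div_pos hδ hC₁
    gcongr
    exact hN k
  have hlog : Tendsto (fun k : ℕ => (k : ℝ)⁻¹ * Real.log ‖x ^ k‖) atTop
      (𝓝 (Real.log (spectralRadius ℂ x).toReal)) := by
    have := (Real.continuousAt_log (zero_lt_one.trans_le hone).ne').tendsto.comp hlim
    refine this.congr fun k => ?_
    rw [Function.comp_apply, Real.log_rpow (hNpos k), one_div]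
  have hlow : Tendsto (fun k : ℕ => (k : ℝ)⁻¹ * Real.log ‖x ^ k‖ - (k : ℝ)⁻¹ * Real.log C₂) atTop
      (𝓝 (Real.log (spectralRadius ℂ x).toReal)) := by
    simpa using hlog.sub (hinv.mul_const (Real.log C₂))
  have hupp : Tendsto (fun k : ℕ => (k : ℝ)⁻¹ * Real.log ‖x ^ k‖ + (k : ℝ)⁻¹ * Real.log C₁) atTop
      (𝓝 (Real.log (spectralRadius ℂ x).toReal)) := by
    simpa using hlog.add (hinv.mul_const (Real.log C₁))
  refine tendsto_of_tendsto_of_tendsto_of_le_of_le hlow hupp (fun k => ?_) fun k => ?_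
  · have h := Real.log_le_log (hNpos k) (h₂ k)
    rw [Real.log_mul hC₂.ne' (hpos k).ne'] at h
    have hk : (0 : ℝ) ≤ (k : ℝ)⁻¹ := by positivity
    dsimp only
    rw [← mul_sub]
    exact mul_le_mul_of_nonneg_left (by linarith) hk
  · have h := Real.log_le_log (hpos k) (h₁ k)
    rw [Real.log_mul hC₁.ne' (hNpos k).ne'] at h
    have hk : (0 : ℝ) ≤ (k : ℝ)⁻¹ := by positivity
    dsimp only
    rw [← mul_add]
    exact mul_le_mul_of_nonneg_left (by linarith) hk

theorem tendsto_log_div_of_functional_pow_comparable {A : Type*} [NormedRing A]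
    [NormedAlgebra ℂ A] [FiniteDimensional ℂ A] (x : A) (ψ : A →ₗ[ℂ] ℂ) {a : ℕ → ℝ} {δ C : ℝ}
    (hδ : 0 < δ) (hC : 0 < C) (hδa : ∀ k, δ ≤ a k) (h₁ : ∀ k, a k ≤ ‖ψ (x ^ k)‖)
    (h₂ : ∀ k, ‖x ^ k‖ ≤ C * a k) :
    Tendsto (fun k : ℕ => (k : ℝ)⁻¹ * Real.log (a k)) atTop
      (𝓝 (Real.log (spectralRadius ℂ x).toReal)) := by
  have : CompleteSpace A := FiniteDimensional.complete ℂ A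
  let ψ' : A →L[ℂ] ℂ := LinearMap.toContinuousLinearMap ψ
  refine tendsto_log_div_of_norm_pow_comparable x (C₁ := ‖ψ'‖ + 1) hδ (by positivity) hC hδa
    (fun k => ?_) h₂
  refine (h₁ k).trans ((ψ'.le_opNorm _).trans ?_)
  gcongr
  linarith

/-- A basis moves the question to matrices, which carry a Banach algebra norm; the spectrum is
unchanged. -/
theorem tendsto_log_div_of_entries_comparable {κ V : Type*} [Fintype κ] [DecidableEq κ]
    [AddCommGroup V] [Module ℂ V] (b : Module.Basis κ ℂ V) (f : Module.End ℂ V)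
    (ψ : Module.End ℂ V →ₗ[ℂ] ℂ) {a : ℕ → ℝ} {δ C : ℝ} (hδ : 0 < δ) (hC : 0 < C)
    (hδa : ∀ k, δ ≤ a k) (h₁ : ∀ k, a k ≤ ‖ψ (f ^ k)‖)
    (h₂ : ∀ k i j, ‖LinearMap.toMatrix b b (f ^ k) i j‖ ≤ C * a k) :
    Tendsto (fun k : ℕ => (k : ℝ)⁻¹ * Real.log (a k)) atTop
      (𝓝 (Real.log (spectralRadius ℂ f).toReal)) := by
  let := Matrix.linftyOpNormedRing (n := κ) (α := ℂ)
  let := Matrix.linftyOpNormedAlgebra (n := κ) (R := ℂ) (α := ℂ)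
  have hsr : spectralRadius ℂ f = spectralRadius ℂ (LinearMap.toMatrixAlgEquiv b f) := by
    simp only [spectralRadius, AlgEquiv.spectrum_eq]
  rw [hsr]
  refine tendsto_log_div_of_functional_pow_comparable _
    (ψ ∘ₗ (LinearMap.toMatrixAlgEquiv b).symm.toLinearMap) (C := Fintype.card κ * C + 1)
    hδ (by positivity) hδa (fun k => ?_) fun k => ?_
  · refine (h₁ k).trans_eq ?_
    rw [← map_pow]
    simp
  · rw [← map_pow]
    have ha : 0 ≤ a k := hδ.le.trans (hδa k)
    refine (matrix_linfty_opNorm_le (x := C * a k) (by positivity) (h₂ k)).trans ?_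
    rw [← mul_assoc]
    gcongr
    linarith

section
variable {c d : ℕ} {T : Matrix (Fin c ⊕ Fin d) (Fin c ⊕ Fin d) ℂ}

theorem exteriorPower_map_pow {R M : Type*} [CommRing R] [AddCommGroup M] [Module R M] (r : ℕ)
    (f : Module.End R M) (k : ℕ) :
    (exteriorPower.map r f : Module.End R (⋀[R]^r M)) ^ k = exteriorPower.map r (f ^ k) := by
  induction k with
  | zero => exact exteriorPower.map_id.symm
  | succ k ih =>
    rw [pow_succ, ih, pow_succ]
    exact (exteriorPower.map_comp f (f ^ k)).symm

theorem tendsto_log_norm_det_pow (hT : T ∈ pseudoUnitary c d) :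
    Tendsto (fun k : ℕ => (k : ℝ)⁻¹ * Real.log ‖(T ^ k).toBlocks₂₂.det‖) atTop
      (𝓝 (Real.log (exteriorSpectralRadius d T))) := by
  classical
  -- An arbitrary order, needed only to index the basis of the exterior power. The coefficient
  -- giving `det D` is therefore defined by `v` and `φ` directly, independently of this order.
  let : LinearOrder (Fin c ⊕ Fin d) := linearOrderOfSTO WellOrderingRel
  let b := Pi.basisFun ℂ (Fin c ⊕ Fin d)
  let v : ⋀[ℂ]^d (Fin c ⊕ Fin d → ℂ) :=
    exteriorPower.ιMulti ℂ d fun i => b (Sum.inr i)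
  let φ : Module.Dual ℂ (⋀[ℂ]^d (Fin c ⊕ Fin d → ℂ)) :=
    exteriorPower.pairingDual ℂ _ d (exteriorPower.ιMulti ℂ d fun i => b.coord (Sum.inr i))
  have hpow : ∀ k, (exteriorPower.map d (Matrix.toLin' T) :
      Module.End ℂ (⋀[ℂ]^d (Fin c ⊕ Fin d → ℂ))) ^ k = exteriorPower.map d (Matrix.toLin' (T ^ k)) :=
    fun k => by rw [exteriorPower_map_pow, Matrix.toLin'_pow]
  refine tendsto_log_div_of_entries_comparable (b.exteriorPower d) _
    (φ ∘ₗ LinearMap.applyₗ v) (δ := (d.factorial : ℝ)⁻¹) (C := (2 * d).factorial)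
    (by positivity) (by positivity) (fun k => ?_) (fun k => ?_) fun k i j => ?_
  · rw [inv_le_iff_one_le_mul₀' (by positivity)]
    exact one_le_factorial_mul_norm_det_toBlocks₂₂ (pseudoUnitary_pow hT k)
  · rw [hpow]
    have : (φ ∘ₗ LinearMap.applyₗ v) (exteriorPower.map d (Matrix.toLin' (T ^ k))) =
        (T ^ k).toBlocks₂₂ᵀ.det := by
      simp only [LinearMap.comp_apply, LinearMap.applyₗ_apply_apply, φ, v,
        exteriorPower.map_apply_ιMulti, exteriorPower.pairingDual_ιMulti_ιMulti]
      congr 1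
      ext i j
      simp [b, toBlocks₂₂, -Matrix.toLin'_pow]
    rw [this, det_transpose]
  · rw [hpow]
    have := norm_det_submatrix_le (pseudoUnitary_pow hT k)
      (Set.powersetCard.ofFinEmbEquiv.symm i) (Set.powersetCard.ofFinEmbEquiv.symm j)
    refine Eq.trans_le ?_ this
    congr 1
    rw [← det_transpose, LinearMap.toMatrix_apply, exteriorPower.basis_repr_apply,
      exteriorPower.basis_apply, exteriorPower.ιMulti_family, exteriorPower.map_apply_ιMulti,
      exteriorPower.ιMultiDual_apply_ιMulti]
    congr 1
    ext p q
    simp [b, -Matrix.toLin'_pow]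

end

/-- The matrix `diag(z 1_c, 1_d)`, which is `phaseMatrix c d θ` at `z = e^{2πiθ}`. -/
noncomputable def scaleMatrix (c d : ℕ) (z : ℂ) : Matrix (Fin c ⊕ Fin d) (Fin c ⊕ Fin d) ℂ :=
  Matrix.fromBlocks (z • 1) 0 0 1

/-- The ordered product `U T_1 U T_2 ⋯ U T_n` with `U = diag(z 1_c, 1_d)`. -/
noncomputable def scaleProduct {c d n : ℕ} (T : Fin n → Matrix (Fin c ⊕ Fin d) (Fin c ⊕ Fin d) ℂ)
    (z : ℂ) : Matrix (Fin c ⊕ Fin d) (Fin c ⊕ Fin d) ℂ :=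
  (List.ofFn fun j => scaleMatrix c d z * T j).prod

/-! ### Holomorphic extension to the disc, and the mean value property. -/

section
variable {c d : ℕ}

/-- The lower right block of the hypothesis says `D*D ≥ 1 + B*B`. -/
theorem det_toBlocks₂₂_ne_zero_of_posSemidef {M : Matrix (Fin c ⊕ Fin d) (Fin c ⊕ Fin d) ℂ}
    (h : (signatureForm c d - Mᴴ * signatureForm c d * M).PosSemidef) : M.toBlocks₂₂.det ≠ 0 := by
  have hK : (M.toBlocks₂₂ᴴ * M.toBlocks₂₂ - 1 - M.toBlocks₁₂ᴴ * M.toBlocks₁₂).PosSemidef := by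
    have h1 : (signatureForm c d - Mᴴ * signatureForm c d * M).toBlocks₂₂.PosSemidef :=
      h.submatrix Sum.inr
    convert h1 using 1
    conv_rhs => rw [← fromBlocks_toBlocks M]
    simp only [signatureForm, fromBlocks_conjTranspose, fromBlocks_multiply, sub_eq_add_neg,
      fromBlocks_neg, fromBlocks_add, toBlocks_fromBlocks₂₂, Matrix.mul_one, Matrix.mul_zero,
      add_zero, zero_add, Matrix.mul_neg, Matrix.neg_mul, neg_add_rev, neg_neg]
    abel
  refine det_ne_zero_of_conjTranspose_mul_self
    (hK.add (posSemidef_conjTranspose_mul_self M.toBlocks₁₂)) ?_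
  abel

/-- `G - (MN)*G(MN) = (G - N*GN) + N*(G - M*GM)N`. -/
theorem posSemidef_signatureForm_sub_mul {M N : Matrix (Fin c ⊕ Fin d) (Fin c ⊕ Fin d) ℂ}
    (hM : (signatureForm c d - Mᴴ * signatureForm c d * M).PosSemidef)
    (hN : (signatureForm c d - Nᴴ * signatureForm c d * N).PosSemidef) :
    (signatureForm c d - (M * N)ᴴ * signatureForm c d * (M * N)).PosSemidef := by
  convert hN.add (hM.conjTranspose_mul_mul_same N) using 1
  rw [Matrix.mul_sub, Matrix.sub_mul, conjTranspose_mul]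
  simp only [Matrix.mul_assoc]
  abel

theorem posSemidef_signatureForm_sub_list_prod
    {l : List (Matrix (Fin c ⊕ Fin d) (Fin c ⊕ Fin d) ℂ)}
    (h : ∀ M ∈ l, (signatureForm c d - Mᴴ * signatureForm c d * M).PosSemidef) :
    (signatureForm c d - l.prodᴴ * signatureForm c d * l.prod).PosSemidef := by
  induction l with
  | nil => simpa using PosSemidef.zero
  | cons M l ih =>
    rw [List.prod_cons]
    exact posSemidef_signatureForm_sub_mul (h M (by simp)) (ih fun N hN => h N (by simp [hN]))

theorem posSemidef_signatureForm_sub_scaleMatrix {z : ℂ} (hz : ‖z‖ ≤ 1) :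
    (signatureForm c d - (scaleMatrix c d z)ᴴ * signatureForm c d * scaleMatrix c d z).PosSemidef := by
  have h0 : (0 : ℂ) ≤ 1 - (‖z‖ : ℂ) ^ 2 := by
    have : (0 : ℝ) ≤ 1 - ‖z‖ ^ 2 := by nlinarith [norm_nonneg z]
    exact_mod_cast this
  have h : signatureForm c d - (scaleMatrix c d z)ᴴ * signatureForm c d * scaleMatrix c d z =
      diagonal (Sum.elim (fun _ : Fin c => 1 - (‖z‖ : ℂ) ^ 2) fun _ : Fin d => (0 : ℂ)) := by
    rw [← fromBlocks_diagonal]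
    simp only [signatureForm, scaleMatrix, fromBlocks_conjTranspose, fromBlocks_multiply,
      sub_eq_add_neg, fromBlocks_neg, fromBlocks_add]
    simp [← Complex.conj_mul', mul_comm, ← diagonal_one, ← diagonal_smul]
  rw [h]
  refine PosSemidef.diagonal ?_
  rintro (i | i)
  · exact h0
  · exact le_rfl

theorem posSemidef_signatureForm_sub_of_mem {T : Matrix (Fin c ⊕ Fin d) (Fin c ⊕ Fin d) ℂ}
    (hT : T ∈ pseudoUnitary c d) :
    (signatureForm c d - Tᴴ * signatureForm c d * T).PosSemidef := by
  rw [hT.out, sub_self]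
  exact PosSemidef.zero

theorem det_toBlocks₂₂_scaleProduct_pow_ne_zero {n : ℕ}
    {T : Fin n → Matrix (Fin c ⊕ Fin d) (Fin c ⊕ Fin d) ℂ} (hT : ∀ j, T j ∈ pseudoUnitary c d)
    {z : ℂ} (hz : ‖z‖ ≤ 1) (k : ℕ) : (scaleProduct T z ^ k).toBlocks₂₂.det ≠ 0 := by
  refine det_toBlocks₂₂_ne_zero_of_posSemidef ?_
  rw [← List.prod_replicate]
  refine posSemidef_signatureForm_sub_list_prod fun M hM => ?_
  rw [List.eq_of_mem_replicate hM]
  refine posSemidef_signatureForm_sub_list_prod fun N hN => ?_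
  obtain ⟨j, rfl⟩ := (List.mem_ofFn' _ _).mp hN
  exact posSemidef_signatureForm_sub_mul (posSemidef_signatureForm_sub_scaleMatrix hz)
    (posSemidef_signatureForm_sub_of_mem (hT j))

theorem norm_exp_two_pi_mul_I (θ : ℝ) : ‖Complex.exp (2 * Real.pi * Complex.I * θ)‖ = 1 := by
  rw [show (2 * Real.pi * Complex.I * θ : ℂ) = ((2 * Real.pi * θ : ℝ) : ℂ) *
      Complex.I by push_cast; ring, Complex.norm_exp_ofReal_mul_I]

theorem phaseMatrix_mem_pseudoUnitary (θ : ℝ) : phaseMatrix c d θ ∈ pseudoUnitary c d := by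
  show _ = _
  have h : (starRingEnd ℂ) (Complex.exp (2 * Real.pi * Complex.I * θ)) *
      Complex.exp (2 * Real.pi * Complex.I * θ) = 1 := by
    rw [Complex.conj_mul', norm_exp_two_pi_mul_I]
    simp
  simp [phaseMatrix, signatureForm, fromBlocks_conjTranspose, fromBlocks_multiply, smul_smul,
    mul_comm _ ((starRingEnd ℂ) _), h]

theorem phaseProduct_mem_pseudoUnitary {n : ℕ}
    {T : Fin n → Matrix (Fin c ⊕ Fin d) (Fin c ⊕ Fin d) ℂ} (hT : ∀ j, T j ∈ pseudoUnitary c d)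
    (θ : ℝ) : phaseProduct T θ ∈ pseudoUnitary c d := by
  have key : ∀ l : List (Matrix (Fin c ⊕ Fin d) (Fin c ⊕ Fin d) ℂ),
      (∀ M ∈ l, M ∈ pseudoUnitary c d) → l.prod ∈ pseudoUnitary c d := by
    intro l hl
    induction l with
    | nil => exact pseudoUnitary_one
    | cons M l ih =>
      rw [List.prod_cons]
      exact pseudoUnitary_mul (hl M (by simp)) (ih fun N hN => hl N (by simp [hN]))
  refine key _ fun N hN => ?_
  obtain ⟨j, rfl⟩ := (List.mem_ofFn' _ _).mp hN
  exact pseudoUnitary_mul (phaseMatrix_mem_pseudoUnitary θ) (hT j)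

theorem toBlocks_list_prod_of_lower {l : List (Matrix (Fin c ⊕ Fin d) (Fin c ⊕ Fin d) ℂ)}
    (h : ∀ M ∈ l, M.toBlocks₁₂ = 0) :
    l.prod.toBlocks₁₂ = 0 ∧
      l.prod.toBlocks₂₂.det = (l.map fun M => M.toBlocks₂₂.det).prod := by
  induction l with
  | nil =>
    rw [List.prod_nil, ← fromBlocks_one, toBlocks_fromBlocks₁₂, toBlocks_fromBlocks₂₂]
    simp
  | cons M l ih =>
    obtain ⟨h1, h2⟩ := ih fun N hN => h N (by simp [hN])
    rw [List.prod_cons, List.map_cons, List.prod_cons, ← h2, ← fromBlocks_toBlocks M,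
      ← fromBlocks_toBlocks l.prod, h1, h M (by simp), fromBlocks_multiply]
    simp

/-- At `z = 0` the upper block row of each factor vanishes, so `D`-blocks simply multiply. -/
theorem det_toBlocks₂₂_scaleProduct_zero_pow {n : ℕ}
    (T : Fin n → Matrix (Fin c ⊕ Fin d) (Fin c ⊕ Fin d) ℂ) (k : ℕ) :
    (scaleProduct T 0 ^ k).toBlocks₂₂.det = (∏ j, (T j).toBlocks₂₂.det) ^ k := by
  have hstep : ∀ j, (scaleMatrix c d 0 * T j).toBlocks₁₂ = 0 ∧
      (scaleMatrix c d 0 * T j).toBlocks₂₂ = (T j).toBlocks₂₂ := by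
    intro j
    conv => rw [← fromBlocks_toBlocks (T j)]
    rw [scaleMatrix, fromBlocks_multiply]
    simp
  have h1 := toBlocks_list_prod_of_lower
    (l := List.ofFn fun j => scaleMatrix c d 0 * T j) (by
      intro M hM
      obtain ⟨j, rfl⟩ := (List.mem_ofFn' _ _).mp hM
      exact (hstep j).1)
  have h2 := toBlocks_list_prod_of_lower (l := List.replicate k (scaleProduct T 0)) (by
    intro M hM
    rw [List.eq_of_mem_replicate hM]
    exact h1.1)
  rw [← List.prod_replicate, h2.2, List.map_replicate, List.prod_replicate, scaleProduct, h1.2,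
    List.map_ofFn, List.prod_ofFn]
  simp [hstep]

theorem differentiable_list_prod_entry {m : Type*} [Fintype m] [DecidableEq m]
    {l : List (ℂ → Matrix m m ℂ)}
    (h : ∀ M ∈ l, ∀ i j, Differentiable ℂ fun z => M z i j) (i j : m) :
    Differentiable ℂ fun z => (l.map fun M => M z).prod i j := by
  induction l generalizing i j with
  | nil => simp
  | cons M l ih =>
    simp only [List.map_cons, List.prod_cons, Matrix.mul_apply]
    exact Differentiable.fun_sum fun p _ => (h M (by simp) i p).mul
      (ih (fun N hN => h N (by simp [hN])) p j)

theorem differentiable_det_of_entry {m : Type*} [Fintype m] [DecidableEq m] {M : ℂ → Matrix m m ℂ}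
    (h : ∀ i j, Differentiable ℂ fun z => M z i j) : Differentiable ℂ fun z => (M z).det := by
  simp only [Matrix.det_apply]
  refine Differentiable.fun_sum fun σ _ => Differentiable.const_smul ?_ _
  exact Differentiable.fun_finsetProd fun i _ => h _ _

theorem differentiable_det_toBlocks₂₂_scaleProduct_pow {n : ℕ}
    (T : Fin n → Matrix (Fin c ⊕ Fin d) (Fin c ⊕ Fin d) ℂ) (k : ℕ) :
    Differentiable ℂ fun z => (scaleProduct T z ^ k).toBlocks₂₂.det := by
  have h0 : ∀ i j, Differentiable ℂ fun z => scaleMatrix c d z i j := by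
    rintro (i | i) (j | j) <;> simp [scaleMatrix]
  have h1 : ∀ i j, Differentiable ℂ fun z => scaleProduct T z i j := by
    intro i j
    have := differentiable_list_prod_entry
      (l := List.ofFn fun j z => scaleMatrix c d z * T j) (by
        intro M hM p q
        obtain ⟨j, rfl⟩ := (List.mem_ofFn' _ _).mp hM
        simp only [Matrix.mul_apply]
        exact Differentiable.fun_sum fun r _ => (h0 p r).mul_const _) i j
    simp only [List.map_ofFn, Function.comp_def] at this
    exact this
  refine differentiable_det_of_entry fun i j => ?_
  have := differentiable_list_prod_entry (l := List.replicate k (scaleProduct T)) (by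
    intro M hM
    rw [List.eq_of_mem_replicate hM]
    exact h1) (Sum.inr i) (Sum.inr j)
  simp only [List.map_replicate, List.prod_replicate] at this
  exact this

theorem norm_list_prod_entry_le {m : Type*} [Fintype m] [DecidableEq m] {l : List (Matrix m m ℂ)}
    {R : ℝ} (hR : 0 ≤ R) (h : ∀ M ∈ l, ∀ i j, ‖M i j‖ ≤ R) (i j : m) :
    ‖l.prod i j‖ ≤ (Fintype.card m * R) ^ l.length := by
  induction l generalizing i j with
  | nil =>
    rw [List.prod_nil, one_apply]
    split_ifs <;> simp
  | cons M l ih =>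
    rw [List.prod_cons, Matrix.mul_apply, List.length_cons, pow_succ]
    calc ‖∑ p, M i p * l.prod p j‖ ≤ ∑ p, ‖M i p * l.prod p j‖ := norm_sum_le _ _
      _ ≤ ∑ _p : m, R * (Fintype.card m * R) ^ l.length := by
        refine Finset.sum_le_sum fun p _ => ?_
        rw [norm_mul]
        exact mul_le_mul (h M (by simp) i p) (ih (fun N hN => h N (by simp [hN])) p j)
          (norm_nonneg _) hR
      _ = _ := by simp; ring

/-- Exponential growth in `k`, uniform in `θ`: after taking `(1/k) log` this becomes the dominating
constant. -/
theorem exists_norm_phaseProduct_entry_le {n : ℕ}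
    (T : Fin n → Matrix (Fin c ⊕ Fin d) (Fin c ⊕ Fin d) ℂ) :
    ∃ W : ℝ, 1 ≤ W ∧ ∀ θ k i j, ‖(phaseProduct T θ ^ k) i j‖ ≤ W ^ k := by
  set R : ℝ := ∑ j, ∑ p, ∑ q, ‖T j p q‖ with hR
  have hR0 : 0 ≤ R := by positivity
  have hRT : ∀ j p q, ‖T j p q‖ ≤ R := fun j p q => by
    refine le_trans ?_ (Finset.single_le_sum (f := fun j => ∑ p, ∑ q, ‖T j p q‖)
      (fun _ _ => by positivity) (Finset.mem_univ j))
    refine le_trans ?_ (Finset.single_le_sum (f := fun p => ∑ q, ‖T j p q‖)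
      (fun _ _ => by positivity) (Finset.mem_univ p))
    exact Finset.single_le_sum (f := fun q => ‖T j p q‖)
      (fun _ _ => by positivity) (Finset.mem_univ q)
  set Q := (Fintype.card (Fin c ⊕ Fin d) * R) ^ n with hQ
  have hQ0 : 0 ≤ Q := by positivity
  refine ⟨max 1 (Fintype.card (Fin c ⊕ Fin d) * Q), le_max_left _ _, fun θ k i j => ?_⟩
  have h1 : ∀ p q, ‖phaseProduct T θ p q‖ ≤ Q := by
    intro p q
    refine (norm_list_prod_entry_le hR0 (fun M hM => ?_) p q).trans_eq (by rw [List.length_ofFn])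
    obtain ⟨j, rfl⟩ := (List.mem_ofFn' _ _).mp hM
    have : phaseMatrix c d θ * T j = fromBlocks
        (Complex.exp (2 * Real.pi * Complex.I * θ) • (T j).toBlocks₁₁)
        (Complex.exp (2 * Real.pi * Complex.I * θ) • (T j).toBlocks₁₂)
        (T j).toBlocks₂₁ (T j).toBlocks₂₂ := by
      conv_lhs => rw [← fromBlocks_toBlocks (T j)]
      rw [phaseMatrix, fromBlocks_multiply]
      simp
    dsimp only
    rw [this]
    rintro (p | p) (q | q)
    · simpa [norm_exp_two_pi_mul_I, toBlocks₁₁, toBlocks₁₂] using hRT j (Sum.inl p) (Sum.inl q)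
    · simpa [norm_exp_two_pi_mul_I, toBlocks₁₁, toBlocks₁₂] using hRT j (Sum.inl p) (Sum.inr q)
    · exact hRT j (Sum.inr p) (Sum.inl q)
    · exact hRT j (Sum.inr p) (Sum.inr q)
  have h2 := norm_list_prod_entry_le (l := List.replicate k (phaseProduct T θ)) hQ0 (by
    intro M hM
    rw [List.eq_of_mem_replicate hM]
    exact h1) i j
  rw [List.prod_replicate, List.length_replicate] at h2
  exact h2.trans (pow_le_pow_left₀ (by positivity) (le_max_right _ _) k)

/-- The mean value property of `log ‖g‖` on the unit circle, parametrized by `[0, 1]`. -/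
theorem integral_log_norm_comp_exp {g : ℂ → ℂ} (hg : Differentiable ℂ g)
    (hg0 : ∀ z, ‖z‖ ≤ 1 → g z ≠ 0) :
    ∫ θ in (0 : ℝ)..1, Real.log ‖g (Complex.exp (2 * Real.pi * Complex.I * θ))‖ =
      Real.log ‖g 0‖ := by
  have h := AnalyticOnNhd.circleAverage_log_norm_of_ne_zero (R := 1) (c := 0) (g := g)
    (fun z _ => hg.analyticAt z) (by simpa using hg0)
  rw [Real.circleAverage_def] at h
  have h2 := intervalIntegral.integral_comp_mul_left (a := 0) (b := 1)
    (fun x : ℝ => Real.log ‖g (circleMap 0 1 x)‖) (c := 2 * Real.pi) (by positivity)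
  rw [mul_zero, mul_one, h] at h2
  rw [← h2]
  refine intervalIntegral.integral_congr fun θ _ => ?_
  simp only [circleMap, zero_add, Complex.ofReal_one, one_mul]
  congr 4
  push_cast
  ring

end

/-! ### Integrals over the phase and passage to the limit. -/

section
variable {c d n : ℕ} {T : Fin n → Matrix (Fin c ⊕ Fin d) (Fin c ⊕ Fin d) ℂ}

theorem continuous_log_norm_det_phaseProduct_pow (hT : ∀ j, T j ∈ pseudoUnitary c d) (k : ℕ) :
    Continuous fun θ : ℝ => Real.log ‖(phaseProduct T θ ^ k).toBlocks₂₂.det‖ := by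
  have h1 : Continuous fun θ : ℝ => (phaseProduct T θ ^ k).toBlocks₂₂.det :=
    (differentiable_det_toBlocks₂₂_scaleProduct_pow T k).continuous.comp
      (show Continuous fun θ : ℝ => Complex.exp (2 * Real.pi * Complex.I * θ) by fun_prop)
  exact h1.norm.log fun θ => norm_ne_zero_iff.mpr
    (det_toBlocks₂₂_ne_zero (pseudoUnitary_pow (phaseProduct_mem_pseudoUnitary hT θ) k))

theorem integral_log_norm_det_phaseProduct_pow (hT : ∀ j, T j ∈ pseudoUnitary c d) (k : ℕ) :
    ∫ θ in (0 : ℝ)..1, Real.log ‖(phaseProduct T θ ^ k).toBlocks₂₂.det‖ =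
      k * ∑ j, sumLogCosh d (T j) := by
  refine (integral_log_norm_comp_exp (differentiable_det_toBlocks₂₂_scaleProduct_pow T k)
    fun z hz => det_toBlocks₂₂_scaleProduct_pow_ne_zero hT hz k).trans ?_
  rw [det_toBlocks₂₂_scaleProduct_zero_pow, norm_pow, Real.log_pow, norm_prod, Real.log_prod
    fun j _ => norm_ne_zero_iff.mpr (det_toBlocks₂₂_ne_zero (hT j))]
  simp only [sumLogCosh_eq_log_norm_det (hT _)]

theorem exists_abs_inv_mul_log_norm_det_le (hT : ∀ j, T j ∈ pseudoUnitary c d) :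
    ∃ K : ℝ, ∀ θ (k : ℕ),
      |(k : ℝ)⁻¹ * Real.log ‖(phaseProduct T θ ^ k).toBlocks₂₂.det‖| ≤ K := by
  obtain ⟨W, hW, hWle⟩ := exists_norm_phaseProduct_entry_le T
  refine ⟨Real.log d.factorial + d * Real.log W, fun θ k => ?_⟩
  have hmem := pseudoUnitary_pow (phaseProduct_mem_pseudoUnitary hT θ) k
  have hW0 : 0 < W := zero_lt_one.trans_le hW
  have hfact : (1 : ℝ) ≤ d.factorial := by exact_mod_cast Nat.one_le_iff_ne_zero.mpr d.factorial_ne_zero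
  have hlogf := Real.log_nonneg hfact
  have hlogW := Real.log_nonneg hW
  have hpos : 0 < ‖(phaseProduct T θ ^ k).toBlocks₂₂.det‖ :=
    norm_pos_iff.mpr (det_toBlocks₂₂_ne_zero hmem)
  have hlow : 0 ≤ Real.log d.factorial + Real.log ‖(phaseProduct T θ ^ k).toBlocks₂₂.det‖ := by
    rw [← Real.log_mul (by positivity) hpos.ne']
    exact Real.log_nonneg (one_le_factorial_mul_norm_det_toBlocks₂₂ hmem)
  have hupp : Real.log ‖(phaseProduct T θ ^ k).toBlocks₂₂.det‖ ≤
      Real.log d.factorial + k * (d * Real.log W) := by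
    have h := norm_det_le (A := (phaseProduct T θ ^ k).toBlocks₂₂)
      fun i j => hWle θ k (Sum.inr i) (Sum.inr j)
    have h' := Real.log_le_log hpos h
    rw [Fintype.card_fin, Real.log_mul (by positivity) (by positivity), Real.log_pow,
      Real.log_pow] at h'
    linarith
  -- At `k = 0` the convention `0⁻¹ = 0` makes the term vanish.
  rcases Nat.eq_zero_or_pos k with rfl | hk
  · simp only [Nat.cast_zero, _root_.inv_zero, zero_mul, abs_zero]
    positivity
  have hk1 : (1 : ℝ) ≤ k := by exact_mod_cast hk
  have hk0 : (0 : ℝ) < k := by positivity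
  have hdW : 0 ≤ d * Real.log W := by positivity
  rw [abs_le, ← div_eq_inv_mul, div_le_iff₀ hk0, le_div_iff₀ hk0]
  constructor <;> nlinarith

/-- Integrability of `f` comes from the approximants, so no regularity of the spectral radius in `θ`
has to be shown separately. -/
theorem tendsto_integral_of_uniformly_bounded {F : ℕ → ℝ → ℝ} {f : ℝ → ℝ} {K : ℝ}
    (hF : ∀ k, Continuous (F k)) (hK : ∀ θ k, |F k θ| ≤ K)
    (hlim : ∀ θ, Tendsto (fun k => F k θ) atTop (𝓝 (f θ))) (a b : ℝ) :
    IntervalIntegrable f MeasureTheory.volume a b ∧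
      Tendsto (fun k => ∫ θ in a..b, F k θ) atTop (𝓝 (∫ θ in a..b, f θ)) := by
  constructor
  · have hmeas : Measurable f := measurable_of_tendsto_metrizable (fun k => (hF k).measurable)
      (tendsto_pi_nhds.mpr hlim)
    refine (intervalIntegrable_const (c := K)).mono_fun' hmeas.aestronglyMeasurable
      (Eventually.of_forall fun θ => ?_)
    exact le_of_tendsto (hlim θ).norm (Eventually.of_forall fun k => hK θ k)
  · exact intervalIntegral.tendsto_integral_filter_of_dominated_convergence (fun _ => K)
      (Eventually.of_forall fun k => (hF k).aestronglyMeasurable)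
      (Eventually.of_forall fun k => Eventually.of_forall fun θ _ => hK θ k)
      intervalIntegrable_const (Eventually.of_forall fun θ _ => hlim θ)

end

end

theorem theorem2 (c d n : ℕ) (T : Fin n → Matrix (Fin c ⊕ Fin d) (Fin c ⊕ Fin d) ℂ)
    (hT : ∀ j, T j ∈ pseudoUnitary c d) :
    (IntervalIntegrable (fun θ : ℝ => sumLogCosh d (phaseProduct T θ)) MeasureTheory.volume 0 1 ∧
      ∫ θ in (0 : ℝ)..1, sumLogCosh d (phaseProduct T θ) = ∑ j, sumLogCosh d (T j)) ∧
    (IntervalIntegrable (fun θ : ℝ => Real.log (exteriorSpectralRadius d (phaseProduct T θ)))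
        MeasureTheory.volume 0 1 ∧
      ∫ θ in (0 : ℝ)..1, Real.log (exteriorSpectralRadius d (phaseProduct T θ)) =
        ∑ j, sumLogCosh d (T j)) := by
  constructor
  · have h : ∀ θ, sumLogCosh d (phaseProduct T θ) =
        Real.log ‖(phaseProduct T θ ^ 1).toBlocks₂₂.det‖ := fun θ => by
      rw [sumLogCosh_eq_log_norm_det (phaseProduct_mem_pseudoUnitary hT θ), pow_one]
    simp only [h]
    refine ⟨(continuous_log_norm_det_phaseProduct_pow hT 1).intervalIntegrable 0 1, ?_⟩
    rw [integral_log_norm_det_phaseProduct_pow hT 1, Nat.cast_one, one_mul]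
  · obtain ⟨K, hK⟩ := exists_abs_inv_mul_log_norm_det_le hT
    obtain ⟨hint, hlim⟩ := tendsto_integral_of_uniformly_bounded
      (fun k => (continuous_log_norm_det_phaseProduct_pow hT k).const_mul _) hK
      (fun θ => tendsto_log_norm_det_pow (phaseProduct_mem_pseudoUnitary hT θ)) 0 1
    -- For `k ≠ 0` the integral of the `k`-th approximant does not depend on `k`.
    refine ⟨hint, tendsto_nhds_unique hlim (tendsto_const_nhds.congr' ?_)⟩
    filter_upwards [Filter.eventually_ne_atTop 0] with k hk
    rw [intervalIntegral.integral_const_mul, integral_log_norm_det_phaseProduct_pow hT k,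
      inv_mul_cancel_left₀ (by exact_mod_cast hk)]
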